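/- Let $X$ be a real or complex Banach space, with scalar field $\mathbb K$, and let $r\ge 1$. The following properties are equivalent. (a) $X$ has a commutative $r$-projectional skeleton, i.e. there are a directed partially ordered set $\Gamma$ and a family $\{P_s\}_{s\in\Gamma}$ of bounded linear projections $P_s\colon X\to X$ with $\|P_s\|\le r$ such that (1) $X=\bigcup_{s\in\Gamma}P_sX$ and each $P_sX$ is separable; (2) $P_s=P_s\circ P_t=P_t\circ P_s$ whenever $s\le t$; (3) if $s_0<s_1<s_2<\cdots$ in $\Gamma$, then $t=\sup_{n}s_n$ exists in $\Gamma$ and $P_tX=\overline{\bigcup_{n}P_{s_n}X}$; (4) $P_s\circ P_t=P_t\circ P_s$ for all $s,t\in\Gamma$. (b) $X$ is $r$-Plichko, i.e. there are a set $\kappa$ and a one-to-one weak$^*$ continuous linear operator $T\colon X^*\to\mathbb K^{\kappa}$ such that, with $\Sigma(\kappa)=\{f\in\mathbb K^\kappa : \{\alpha : f(\alpha)\ne 0\}\text{ is countable}\}$, the set $D=T^{-1}(\Sigma(\kappa))\subseteq X^*$ is $r$-norming, i.e. $\|x\|\le r\,\sup\{|\varphi(x)|/\|\varphi\| : \varphi\in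 D\setminus\{0\}\}$ for every $x\in X$ (with $\sup\emptyset=0$). -/

import Mathlib

universe u v w

/-- The set `D` of functionals is `r`-norming: `‖x‖ ≤ r |x|` for all `x`, where
`|x| = sup {|φ(x)| / ‖φ‖ : φ ∈ D, φ ≠ 0}`. The set under the supremum is always bounded above
by `‖x‖`; the supremum of the empty set is `0`. -/
def IsNorming (𝕜 : Type*) {X : Type*} [RCLike 𝕜] [NormedAddCommGroup X] [NormedSpace 𝕜 X]
    (r : ℝ) (D : Set (StrongDual 𝕜 X)) : Prop :=
  ∀ x : X, ‖x‖ ≤ r * sSup ((fun φ : StrongDual 𝕜 X => ‖φ x‖ / ‖φ‖) '' (D \ {0}))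

/-- The `Σ`-product: the elements of `𝕜 ^ κ` with countable support. -/
def sigmaProduct (𝕜 κ : Type*) [Zero 𝕜] : Set (κ → 𝕜) :=
  {f | (Function.support f).Countable}

/-- `X` is `r`-Plichko: there is a one-to-one weak* continuous linear operator
`T : X* → 𝕜 ^ κ` such that the preimage of the `Σ`-product is `r`-norming for `X`. -/
def IsPlichko (𝕜 : Type w) (X : Type u) [RCLike 𝕜] [NormedAddCommGroup X]
    [NormedSpace 𝕜 X] (r : ℝ) : Prop :=
  ∃ (κ : Type u) (T : WeakDual 𝕜 X →L[𝕜] (κ → 𝕜)),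
    Function.Injective T ∧
      IsNorming 𝕜 r {φ : StrongDual 𝕜 X | T (StrongDual.toWeakDual φ) ∈ sigmaProduct 𝕜 κ}

/-- A family of bounded linear operators indexed by a partially ordered set is a projectional
skeleton in `X`. -/
structure IsProjectionalSkeleton {𝕜 X Γ : Type*} [RCLike 𝕜] [NormedAddCommGroup X]
    [NormedSpace 𝕜 X] [PartialOrder Γ] (P : Γ → X →L[𝕜] X) : Prop where
  directed : ∀ s t : Γ, ∃ u : Γ, s ≤ u ∧ t ≤ u
  projection : ∀ s, P s ∘L P s = P s
  cover : ∀ x : X, ∃ s, x ∈ Set.range (P s)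
  separable : ∀ s, TopologicalSpace.IsSeparable (Set.range (P s))
  compat : ∀ s t, s ≤ t → P s = P s ∘L P t ∧ P s = P t ∘L P s
  sigma_complete : ∀ s : ℕ → Γ, StrictMono s →
    ∃ t, IsLUB (Set.range s) t ∧ Set.range (P t) = closure (⋃ n, Set.range (P (s n)))
  bounded : BddAbove (Set.range fun s => ‖P s‖)

/-- `X` has a commutative `r`-projectional skeleton. The index set ranges over all partially
ordered sets in the universe `v`. -/
def HasCommutativeProjectionalSkeleton (𝕜 : Type w) (X : Type u) [RCLike 𝕜]
    [NormedAddCommGroup X] [NormedSpace 𝕜 X] (r : ℝ) : Prop :=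
  ∃ (Γ : Type v) (_ : PartialOrder Γ) (P : Γ → X →L[𝕜] X),
    IsProjectionalSkeleton P ∧ (∀ s, ‖P s‖ ≤ r) ∧ ∀ s t, P s ∘L P t = P t ∘L P s

/-! From (b) to (a): the coordinates of `T` are evaluations at points x_i. Injectivity of `T` makes
their span dense, and D consists of the functionals that are nonzero at only countably many x_i.
Closing a countable index set under the supports of almost norming functionals gives a countable C
for which fixing x_i for i in C and killing the other x_i defines a projection of norm at most r
(`exists_isSplitting_superset`). These projections, ordered by inclusion of C, form the skeleton.

From (a) to (b): it suffices to find a linearly dense A on which every φ ∘ P_s has countable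
support. Then `T` evaluates at A, and if x = P_s x and g norms x, the functional g ∘ P_s lies in D,
has norm at most r and agrees with g at x. To build A, pass to limits R_S of the projections for
arbitrary S ⊆ Γ and induct on the cardinality of S (`exists_countablySupporting`): well-order S with
small initial segments and collect the images, under the increments of R along the chain, of the
sets found for the segments. Supports stay countable because each point sees countably many
increments (`countable_increment_ne_zero`), P_s X is separable, and P_s commutes with the
increments. -/

section Plichko

variable {𝕜 X κ : Type*} [RCLike 𝕜] [NormedAddCommGroup X] [NormedSpace 𝕜 X]

/-! ### Duality and separation -/

/-- A functional in the weak* dual of the weak* topology is an evaluation. -/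
theorem WeakDual.exists_eq_eval (f : WeakDual 𝕜 X →L[𝕜] 𝕜) :
    ∃ x : X, ∀ φ : StrongDual 𝕜 X, f (StrongDual.toWeakDual φ) = φ x := by
  obtain ⟨x, hx⟩ := LinearMap.dualEmbedding_surjective (topDualPairing 𝕜 X) f
  exact ⟨x, fun φ => by rw [← hx]; rfl⟩

theorem Submodule.exists_dual_ne_zero_of_notMem {N : Submodule 𝕜 X} (hN : IsClosed (N : Set X))
    {x : X} (hx : x ∉ N) : ∃ φ : StrongDual 𝕜 X, (∀ y ∈ N, φ y = 0) ∧ φ x ≠ 0 := by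
  have : IsClosed (N : Set X) := hN
  have h0 : (N.mkQ x) ≠ 0 := by simpa using hx
  obtain ⟨f, hf⟩ := SeparatingDual.exists_ne_zero (R := 𝕜) h0
  refine ⟨f.comp N.mkQL, fun y hy => ?_, hf⟩
  have : N.mkQ y = 0 := by simpa using hy
  change f (N.mkQ y) = 0
  rw [this, map_zero]

theorem Submodule.dense_of_forall_dual {N : Submodule 𝕜 X}
    (h : ∀ φ : StrongDual 𝕜 X, (∀ y ∈ N, φ y = 0) → φ = 0) : Dense (N : Set X) := by
  rw [Submodule.dense_iff_topologicalClosure_eq_top, eq_top_iff]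
  intro x _
  by_contra hx
  obtain ⟨φ, h1, h2⟩ :=
    Submodule.exists_dual_ne_zero_of_notMem N.isClosed_topologicalClosure hx
  have := h φ fun y hy => h1 y (N.le_topologicalClosure hy)
  simp [this] at h2

/-! ### Splitting index sets and their projections -/

variable (𝕜) in
/-- The set `C` of indices splits the family `x`: the canonical projection of the span of `x`
onto the span of `x '' C` along the span of `x '' Cᶜ` has norm at most `r`. -/
def IsSplitting (r : ℝ) (x : κ → X) (C : Set κ) : Prop :=
  ∀ y ∈ Submodule.span 𝕜 (x '' C), ∀ z ∈ Submodule.span 𝕜 (x '' Cᶜ), ‖y‖ ≤ r * ‖y + z‖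

variable {r : ℝ} {x : κ → X} {C : Set κ}

theorem IsSplitting.norm_le_of_mem_closure (h : IsSplitting 𝕜 r x C) {y z : X}
    (hy : y ∈ (Submodule.span 𝕜 (x '' C)).topologicalClosure)
    (hz : z ∈ (Submodule.span 𝕜 (x '' Cᶜ)).topologicalClosure) : ‖y‖ ≤ r * ‖y + z‖ := by
  have hyz : (y, z) ∈ closure ((Submodule.span 𝕜 (x '' C) : Set X) ×ˢ
      (Submodule.span 𝕜 (x '' Cᶜ) : Set X)) := by
    rw [closure_prod_eq]; exact ⟨hy, hz⟩
  have hcl : IsClosed {p : X × X | ‖p.1‖ ≤ r * ‖p.1 + p.2‖} :=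
    isClosed_le (by fun_prop) (by fun_prop)
  exact closure_minimal (fun p hp => h p.1 hp.1 p.2 hp.2) hcl hyz

/-- The norm bound makes the sum map E × F → X bounded below, so E + F is closed; it contains every
x_i, hence is all of X. -/
theorem IsSplitting.isCompl [CompleteSpace X] (h : IsSplitting 𝕜 r x C)
    (hx : Dense (Submodule.span 𝕜 (Set.range x) : Set X)) :
    IsCompl (Submodule.span 𝕜 (x '' C)).topologicalClosure
      (Submodule.span 𝕜 (x '' Cᶜ)).topologicalClosure := by
  set E := (Submodule.span 𝕜 (x '' C)).topologicalClosure with hE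
  set F := (Submodule.span 𝕜 (x '' Cᶜ)).topologicalClosure with hF
  have hEc : IsClosed (E : Set X) := Submodule.isClosed_topologicalClosure _
  have hFc : IsClosed (F : Set X) := Submodule.isClosed_topologicalClosure _
  have : CompleteSpace E := hEc.completeSpace_coe
  have : CompleteSpace F := hFc.completeSpace_coe
  refine ⟨Submodule.disjoint_def.2 fun y hy hy' => ?_, codisjoint_iff.2 ?_⟩
  · have := h.norm_le_of_mem_closure hy (F.neg_mem hy')
    simpa using this
  · let S : (E × F) →L[𝕜] X := E.subtypeL.coprod F.subtypeL
    have hS : AntilipschitzWith (Real.toNNReal (|r| + 1)) S := by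
      refine AddMonoidHomClass.antilipschitz_of_bound S fun p => ?_
      rw [Real.coe_toNNReal _ (by positivity)]
      have h1 : ‖(p.1 : X)‖ ≤ |r| * ‖(p.1 : X) + p.2‖ :=
        (h.norm_le_of_mem_closure p.1.2 p.2.2).trans (by gcongr; exact le_abs_self r)
      have h2 : ‖(p.2 : X)‖ ≤ ‖(p.1 : X) + p.2‖ + ‖(p.1 : X)‖ := by
        simpa using norm_sub_le ((p.1 : X) + p.2) p.1
      have h3 := norm_nonneg ((p.1 : X) + p.2)
      change max ‖(p.1 : X)‖ ‖(p.2 : X)‖ ≤ (|r| + 1) * ‖(p.1 : X) + p.2‖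
      apply max_le <;> nlinarith
    have hcl : IsClosed (Set.range S) := hS.isClosed_range S.uniformContinuous
    have hr : LinearMap.range (S : (E × F) →ₗ[𝕜] X) = E ⊔ F := by
      simp [S, LinearMap.range_coprod]
    have hcl' : IsClosed ((E ⊔ F : Submodule 𝕜 X) : Set X) := by
      rw [← hr]; exact hcl
    have hle : Submodule.span 𝕜 (Set.range x) ≤ E ⊔ F := by
      rw [Submodule.span_le]
      rintro _ ⟨i, rfl⟩
      by_cases hi : i ∈ C
      · exact Submodule.mem_sup_left
          (Submodule.le_topologicalClosure _ (Submodule.subset_span ⟨i, hi, rfl⟩))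
      · exact Submodule.mem_sup_right
          (Submodule.le_topologicalClosure _ (Submodule.subset_span ⟨i, hi, rfl⟩))
    rw [eq_top_iff]
    intro y _
    exact closure_minimal hle hcl' (hx y)

theorem IsSplitting.exists_projection [CompleteSpace X] (h : IsSplitting 𝕜 r x C) (hr : 0 ≤ r)
    (hx : Dense (Submodule.span 𝕜 (Set.range x) : Set X)) :
    ∃ P : X →L[𝕜] X, ‖P‖ ≤ r ∧ (∀ i ∈ C, P (x i) = x i) ∧ (∀ i ∉ C, P (x i) = 0) ∧
      Set.range P = closure (Submodule.span 𝕜 (x '' C) : Set X) := by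
  have hc := h.isCompl hx
  set E := (Submodule.span 𝕜 (x '' C)).topologicalClosure with hE
  set F := (Submodule.span 𝕜 (x '' Cᶜ)).topologicalClosure with hF
  let P := (Submodule.projection E F hc).mkContinuous r fun y => by
    have := h.norm_le_of_mem_closure (Submodule.projection_apply_mem hc y) (Submodule.sub_projection_mem hc y)
    simpa using this
  refine ⟨P, LinearMap.mkContinuous_norm_le _ hr _, fun i hi => ?_, fun i hi => ?_, ?_⟩
  · exact Submodule.projection_apply_of_mem_left hc
      (Submodule.le_topologicalClosure _ (Submodule.subset_span ⟨i, hi, rfl⟩))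
  · exact (Submodule.projection_apply_eq_zero_iff hc).2
      (Submodule.le_topologicalClosure _ (Submodule.subset_span ⟨i, hi, rfl⟩))
  · have := congrArg (fun M : Submodule 𝕜 X => (M : Set X)) (Submodule.range_projection hc)
    exact this

/-! ### Countable splitting sets from a norming D -/

/-- Approximate norming functionals in the unit ball. -/
theorem IsNorming.exists_le {D : Submodule 𝕜 (StrongDual 𝕜 X)}
    (hD : IsNorming 𝕜 r (D : Set (StrongDual 𝕜 X))) (hr : 0 < r) (y : X) {ε : ℝ} (hε : 0 < ε) :
    ∃ φ ∈ D, ‖φ‖ ≤ 1 ∧ ‖y‖ ≤ r * ‖φ y‖ + ε := by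
  have h := hD y
  set S := (fun φ : StrongDual 𝕜 X => ‖φ y‖ / ‖φ‖) '' ((D : Set (StrongDual 𝕜 X)) \ {0}) with hS
  rcases S.eq_empty_or_nonempty with h0 | h0
  · rw [h0, Real.sSup_empty] at h
    exact ⟨0, D.zero_mem, by simp, by simp; linarith⟩
  · obtain ⟨_, ⟨φ, ⟨hφ, hφ0⟩, rfl⟩, hlt⟩ := exists_lt_of_lt_csSup h0
      (show sSup S - ε / r < sSup S by have := div_pos hε hr; linarith)
    have hn : ‖φ‖ ≠ 0 := by simpa using hφ0
    refine ⟨((‖φ‖⁻¹ : ℝ) : 𝕜) • φ, D.smul_mem _ hφ, ?_, ?_⟩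
    · rw [norm_smul]; simp [hn]
    · have : ‖(((‖φ‖⁻¹ : ℝ) : 𝕜) • φ) y‖ = ‖φ y‖ / ‖φ‖ := by
        simp [div_eq_inv_mul]
      rw [this]
      have h2 : r * (sSup S - ε / r) ≤ r * (‖φ y‖ / ‖φ‖) := by gcongr
      rw [mul_sub, mul_div_cancel₀ _ hr.ne'] at h2
      linarith

variable (𝕜) in
/-- The functionals with countable support on the family `x`. -/
def countablySupported (x : κ → X) : Submodule 𝕜 (StrongDual 𝕜 X) where
  carrier := {φ | {i | φ (x i) ≠ 0}.Countable}
  zero_mem' := by simp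
  add_mem' {φ ψ} hφ hψ := (Set.Countable.union hφ hψ).mono fun i hi => by
    by_contra hc
    simp only [Set.mem_union, Set.mem_ofPred_eq, not_or, not_not] at hc
    exact hi (by simp [hc.1, hc.2])
  smul_mem' c φ hφ := Set.Countable.mono (fun i hi => by
    intro hc
    exact hi (by simp [hc])) hφ

/-- Adjoin to C the supports of functionals almost norming a countable dense set of the span. Such a
functional vanishes on z, so it sees y + z as y. -/
theorem exists_countable_superset_norming (hr : 0 < r)
    (hD : IsNorming 𝕜 r (countablySupported 𝕜 x : Set (StrongDual 𝕜 X))) (hC : C.Countable) :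
    ∃ C', C ⊆ C' ∧ C'.Countable ∧ ∀ y ∈ Submodule.span 𝕜 (x '' C),
      ∀ z ∈ Submodule.span 𝕜 (x '' C'ᶜ), ‖y‖ ≤ r * ‖y + z‖ := by
  obtain ⟨c, hc, hsc⟩ : TopologicalSpace.IsSeparable (Submodule.span 𝕜 (x '' C) : Set X) :=
    (hC.image x).isSeparable.span
  choose f hfD hf1 hf2 using fun (y : X) (n : ℕ) =>
    hD.exists_le hr y (ε := 1 / ((n : ℝ) + 1)) (by positivity)
  refine ⟨C ∪ ⋃ y ∈ c, ⋃ n, {i | f y n (x i) ≠ 0}, Set.subset_union_left,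
    hC.union (hc.biUnion fun y _ => Set.countable_iUnion fun n => hfD y n), fun y hy z hz => ?_⟩
  refine le_of_forall_pos_le_add fun ε hε => ?_
  obtain ⟨n, hn⟩ := exists_nat_one_div_lt (half_pos hε)
  -- Replacing y by d costs (r + 1)‖y - d‖ in total, at most ε / 2.
  obtain ⟨d, hd, hyd⟩ := Metric.mem_closure_iff.1 (hsc hy) (ε / (2 * (r + 1))) (by positivity)
  rw [dist_eq_norm] at hyd
  have hz0 : f d n z = 0 := by
    have : Submodule.span 𝕜 (x '' (C ∪ ⋃ y ∈ c, ⋃ n, {i | f y n (x i) ≠ 0})ᶜ) ≤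
        LinearMap.ker (f d n : X →ₗ[𝕜] 𝕜) := by
      rw [Submodule.span_le]
      rintro _ ⟨i, hi, rfl⟩
      by_contra hne
      exact hi (Or.inr (Set.mem_biUnion hd (Set.mem_iUnion.2 ⟨n, hne⟩)))
    exact this hz
  have h1 : ‖f d n (y + z)‖ ≤ ‖y + z‖ := by
    simpa using (f d n).le_of_opNorm_le (hf1 d n) (y + z)
  have h2 : ‖f d n (y - d)‖ ≤ ‖y - d‖ := by
    simpa using (f d n).le_of_opNorm_le (hf1 d n) (y - d)
  have h3 : ‖f d n d‖ ≤ ‖f d n (y + z)‖ + ‖f d n (y - d)‖ := by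
    have : f d n d = f d n (y + z) - f d n (y - d) := by simp [hz0]
    rw [this]; exact norm_sub_le _ _
  have h4 : ‖y‖ ≤ ‖d‖ + ‖y - d‖ := by
    simpa using norm_add_le d (y - d)
  have h5 := hf2 d n
  have h6 : (r + 1) * ‖y - d‖ ≤ ε / 2 := by
    rw [lt_div_iff₀ (by positivity)] at hyd
    linarith
  have h7 : r * ‖f d n d‖ ≤ r * (‖y + z‖ + ‖y - d‖) := by gcongr; linarith
  linarith

theorem isSplitting_iUnion {s : ℕ → Set κ} (hs : Monotone s)
    (h : ∀ n, ∀ y ∈ Submodule.span 𝕜 (x '' s n), ∀ z ∈ Submodule.span 𝕜 (x '' (⋃ n, s n)ᶜ),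
      ‖y‖ ≤ r * ‖y + z‖) : IsSplitting 𝕜 r x (⋃ n, s n) := by
  intro y hy z hz
  rw [Set.image_iUnion, Submodule.span_iUnion] at hy
  have hm : Monotone fun n => Submodule.span 𝕜 (x '' s n) := fun m n hmn =>
    Submodule.span_mono (Set.image_mono (hs hmn))
  obtain ⟨n, hn⟩ := (Submodule.mem_iSup_of_directed _ hm.directed_le).1 hy
  exact h n y hn z hz

/-- Iterate the enlargement ω times: a vector supported off the union is supported off stage n + 1,
which is what stage n needs. -/
theorem exists_isSplitting_superset (hr : 0 < r)
    (hD : IsNorming 𝕜 r (countablySupported 𝕜 x : Set (StrongDual 𝕜 X))) (hC : C.Countable) :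
    ∃ C', C ⊆ C' ∧ C'.Countable ∧ IsSplitting 𝕜 r x C' := by
  choose g hg1 hg2 hg3 using fun B : {B : Set κ // B.Countable} =>
    exists_countable_superset_norming hr hD B.2
  let s : ℕ → {B : Set κ // B.Countable} := fun n => n.rec ⟨C, hC⟩ fun _ B => ⟨g B, hg2 B⟩
  have hs : Monotone fun n : ℕ => (s n).1 := by
    refine monotone_nat_of_le_succ fun n => ?_
    exact hg1 (s n)
  refine ⟨⋃ n, (s n).1, Set.subset_iUnion (fun n => (s n).1) 0,
    Set.countable_iUnion fun n => (s n).2, isSplitting_iUnion hs fun n y hy z hz => ?_⟩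
  refine hg3 (s n) y hy z (Submodule.span_mono (Set.image_mono (Set.compl_subset_compl.2 ?_)) hz)
  exact Set.subset_iUnion (fun n => (s n).1) (n + 1)

theorem exists_countable_mem_closure_span
    (hx : Dense (Submodule.span 𝕜 (Set.range x) : Set X)) (y : X) :
    ∃ C : Set κ, C.Countable ∧ y ∈ closure (Submodule.span 𝕜 (x '' C) : Set X) := by
  have h1 : ∀ z ∈ Submodule.span 𝕜 (Set.range x), ∃ C : Set κ, C.Countable ∧
      z ∈ Submodule.span 𝕜 (x '' C) := by
    intro z hz
    rw [← Set.image_univ] at hz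
    obtain ⟨t, -, hz⟩ := Submodule.mem_span_image_iff_exists_fun 𝕜 |>.1 hz
    obtain ⟨c, hc⟩ := hz
    refine ⟨t, t.countable_toSet, hc ▸ Submodule.sum_mem _ fun i _ => ?_⟩
    exact Submodule.smul_mem _ _ (Submodule.subset_span ⟨i, i.2, rfl⟩)
  choose! g hg1 hg2 using h1
  obtain ⟨s, hs, hlim⟩ := mem_closure_iff_seq_limit.1 (hx y)
  refine ⟨⋃ n, g (s n), Set.countable_iUnion fun n => hg1 _ (hs n), ?_⟩
  refine mem_closure_of_tendsto hlim (Filter.Eventually.of_forall fun n => ?_)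
  exact Submodule.span_mono (Set.image_mono (Set.subset_iUnion (fun n => g (s n)) n))
    (hg2 _ (hs n))

theorem ContinuousLinearMap.ext_of_dense_span {P Q : X →L[𝕜] X}
    (hx : Dense (Submodule.span 𝕜 (Set.range x) : Set X)) (h : ∀ i, P (x i) = Q (x i)) :
    P = Q :=
  ContinuousLinearMap.ext_on hx (by rintro _ ⟨i, rfl⟩; exact h i)

end Plichko

/-! ### From a norming D to a skeleton -/

theorem hasCommutativeProjectionalSkeleton_of_isNorming {𝕜 : Type w} {X κ : Type u} [RCLike 𝕜]
    [NormedAddCommGroup X] [NormedSpace 𝕜 X] [CompleteSpace X] {r : ℝ} (hr : 0 < r) {x : κ → X}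
    (hx : Dense (Submodule.span 𝕜 (Set.range x) : Set X))
    (hD : IsNorming 𝕜 r (countablySupported 𝕜 x : Set (StrongDual 𝕜 X))) :
    HasCommutativeProjectionalSkeleton.{u, max u v, w} 𝕜 X r := by
  classical
  let Γ : Type (max u v) := ULift.{max u v} {C : Set κ // C.Countable ∧ IsSplitting 𝕜 r x C}
  choose P hPr hP1 hP0 hPran using fun s : Γ => s.down.2.2.exists_projection hr.le hx
  have hcomp : ∀ s t : Γ, ∀ i, P s (P t (x i)) =
      if i ∈ s.down.1 ∧ i ∈ t.down.1 then x i else 0 := by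
    intro s t i
    by_cases ht : i ∈ t.down.1
    · by_cases hs : i ∈ s.down.1
      · simp [ht, hs, hP1 t i ht, hP1 s i hs]
      · simp [ht, hs, hP1 t i ht, hP0 s i hs]
    · simp [ht, hP0 t i ht]
  have happ : ∀ s : Γ, ∀ i, P s (x i) = if i ∈ s.down.1 then x i else 0 := by
    intro s i
    by_cases hs : i ∈ s.down.1
    · simp [hs, hP1 s i hs]
    · simp [hs, hP0 s i hs]
  refine ⟨Γ, inferInstance, P, ⟨?_, ?_, ?_, ?_, ?_, ?_, ?_⟩, hPr, ?_⟩
  · intro s t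
    obtain ⟨C, hC, hC1, hC2⟩ := exists_isSplitting_superset hr hD
      (s.down.2.1.union t.down.2.1)
    exact ⟨⟨C, hC1, hC2⟩, Set.subset_union_left.trans hC, Set.subset_union_right.trans hC⟩
  · intro s
    refine ContinuousLinearMap.ext_of_dense_span hx fun i => ?_
    rw [ContinuousLinearMap.comp_apply, hcomp, happ]
    simp only [and_self]
  · intro y
    obtain ⟨C, hC, hy⟩ := exists_countable_mem_closure_span hx y
    obtain ⟨C', h1, h2, h3⟩ := exists_isSplitting_superset hr hD hC
    refine ⟨⟨C', h2, h3⟩, ?_⟩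
    rw [hPran]
    exact closure_mono (Submodule.span_mono (Set.image_mono h1)) hy
  · intro s
    rw [hPran]
    exact (s.down.2.1.image x).isSeparable.span.closure
  · intro s t hst
    have hst' : s.down.1 ⊆ t.down.1 := hst
    constructor <;> refine ContinuousLinearMap.ext_of_dense_span hx fun i => ?_ <;>
      rw [ContinuousLinearMap.comp_apply, hcomp, happ] <;>
      by_cases hi : i ∈ s.down.1 <;> simp [hi, @hst' i]
  · intro s hs
    have hm : Monotone fun n => (s n).down.1 := fun m n hmn => hs.monotone hmn
    refine ⟨⟨⋃ n, (s n).down.1, Set.countable_iUnion fun n => (s n).down.2.1,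
      isSplitting_iUnion hm fun n y hy z hz => (s n).down.2.2 y hy z
        (Submodule.span_mono (Set.image_mono (Set.compl_subset_compl.2
          (Set.subset_iUnion (fun n => (s n).down.1) n))) hz)⟩, ⟨?_, ?_⟩, ?_⟩
    · rintro _ ⟨n, rfl⟩
      exact Set.subset_iUnion (fun n => (s n).down.1) n
    · intro t ht
      exact Set.iUnion_subset fun n => ht ⟨n, rfl⟩
    · simp only [hPran]
      apply subset_antisymm
      · apply closure_mono
        intro y hy
        have hm' : Monotone fun n => Submodule.span 𝕜 (x '' (s n).down.1) := fun m n hmn =>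
          Submodule.span_mono (Set.image_mono (hm hmn))
        rw [Set.image_iUnion, SetLike.mem_coe, Submodule.span_iUnion] at hy
        obtain ⟨n, hn⟩ := (Submodule.mem_iSup_of_directed _ hm'.directed_le).1 hy
        exact Set.mem_iUnion.2 ⟨n, subset_closure hn⟩
      · refine closure_minimal (Set.iUnion_subset fun n => closure_mono ?_) isClosed_closure
        exact Submodule.span_mono (Set.image_mono (Set.subset_iUnion (fun n => (s n).down.1) n))
  · exact ⟨r, by rintro _ ⟨s, rfl⟩; exact hPr s⟩
  · intro s t
    refine ContinuousLinearMap.ext_of_dense_span hx fun i => ?_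
    simp only [ContinuousLinearMap.comp_apply, hcomp, and_comm]

theorem IsPlichko.hasCommutativeProjectionalSkeleton {𝕜 : Type w} {X : Type u} [RCLike 𝕜]
    [NormedAddCommGroup X] [NormedSpace 𝕜 X] [CompleteSpace X] {r : ℝ} (hr : 0 < r)
    (h : IsPlichko.{u, w} 𝕜 X r) : HasCommutativeProjectionalSkeleton.{u, max u v, w} 𝕜 X r := by
  obtain ⟨κ, T, hT, hD⟩ := h
  choose x hx using fun i : κ =>
    WeakDual.exists_eq_eval ((ContinuousLinearMap.proj (R := 𝕜) (φ := fun _ : κ => 𝕜) i).comp T)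
  have hx' : ∀ (φ : StrongDual 𝕜 X) (i : κ), T (StrongDual.toWeakDual φ) i = φ (x i) :=
    fun φ i => hx i φ
  refine hasCommutativeProjectionalSkeleton_of_isNorming hr (x := x) ?_ ?_
  · refine Submodule.dense_of_forall_dual fun φ hφ => ?_
    apply StrongDual.toWeakDual.injective
    apply hT
    rw [map_zero, map_zero]
    funext i
    rw [hx', hφ _ (Submodule.subset_span ⟨i, rfl⟩)]
    rfl
  · convert hD using 1
    ext φ
    simp only [sigmaProduct, Function.support, Set.mem_ofPred_eq, hx']
    rfl

/-! ### Limits of skeleton projections along monotone families -/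

section Skeleton

open Filter Topology

/-- In a directed preorder, upper bounds of finite sets can be chosen monotonically. -/
theorem exists_monotone_finset_upperBound {Γ : Type*} [Preorder Γ] [Nonempty Γ]
    (hd : ∀ s t : Γ, ∃ u : Γ, s ≤ u ∧ t ≤ u) :
    ∃ u : Finset Γ → Γ, Monotone u ∧ ∀ s, s ≤ u {s} := by
  classical
  have : IsDirectedOrder Γ := ⟨hd⟩
  choose b hb using fun F : Finset Γ => F.exists_le
  -- Strong recursion: bound F together with the values already chosen at its proper subsets, which
  -- forces monotonicity.
  let H : ∀ F : Finset Γ, (∀ G, G ⊂ F → Γ) → Γ := fun F ih =>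
    b (F ∪ F.ssubsets.attach.image fun G => ih G.1 (Finset.mem_ssubsets.1 G.2))
  let u : Finset Γ → Γ := Finset.strongInduction H
  have hu : ∀ F, u F = H F fun G _ => u G := fun F => Finset.strongInduction_eq H F
  refine ⟨u, fun G F hGF => ?_, fun s => ?_⟩
  · rcases hGF.eq_or_lt with rfl | hlt
    · exact le_rfl
    · rw [hu F]
      refine hb _ _ (Finset.mem_union_right _ (Finset.mem_image.2
        ⟨⟨G, Finset.mem_ssubsets.2 hlt⟩, Finset.mem_attach _ _, rfl⟩))
  · rw [hu]
    exact hb _ _ (by simp)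

namespace IsProjectionalSkeleton

variable {𝕜 X Γ : Type*} [RCLike 𝕜] [NormedAddCommGroup X] [NormedSpace 𝕜 X]
  [PartialOrder Γ] {P : Γ → X →L[𝕜] X}

theorem apply_apply_of_le (hP : IsProjectionalSkeleton P) {s t : Γ} (h : s ≤ t) (x : X) :
    P s (P t x) = P s x :=
  (DFunLike.congr_fun (hP.compat s t h).1 x).symm

theorem apply_apply_of_ge (hP : IsProjectionalSkeleton P) {s t : Γ} (h : s ≤ t) (x : X) :
    P t (P s x) = P s x :=
  (DFunLike.congr_fun (hP.compat s t h).2 x).symm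

/-- The limit is P_t x for the supremum t: P_t x is close to some P_{s_N} w, which all later
projections fix. -/
theorem cauchySeq_of_strictMono (hP : IsProjectionalSkeleton P) {r : ℝ} (hr : ∀ s, ‖P s‖ ≤ r)
    {s : ℕ → Γ} (hs : StrictMono s) (x : X) : CauchySeq fun n => P (s n) x := by
  obtain ⟨t, ht, hran⟩ := hP.sigma_complete s hs
  have hr0 : 0 ≤ r := (norm_nonneg _).trans (hr t)
  suffices h : Tendsto (fun n => P (s n) x) atTop (𝓝 (P t x)) from h.cauchySeq
  rw [Metric.tendsto_atTop]
  intro ε hε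
  have hy : P t x ∈ closure (⋃ n, Set.range (P (s n))) := hran ▸ ⟨x, rfl⟩
  obtain ⟨z, hz, hd⟩ := Metric.mem_closure_iff.1 hy (ε / (r + 1)) (by positivity)
  obtain ⟨N, w, rfl⟩ := Set.mem_iUnion.1 hz
  refine ⟨N, fun n hn => ?_⟩
  rw [dist_eq_norm, lt_div_iff₀ (by positivity)] at hd
  rw [dist_eq_norm]
  have h1 : P (s n) x - P t x =
      P (s n) (P t x - P (s N) w) - (P t x - P (s N) w) := by
    rw [map_sub, hP.apply_apply_of_le (ht.1 ⟨n, rfl⟩),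
      hP.apply_apply_of_ge (hs.monotone hn)]
    abel
  rw [h1]
  have h2 := norm_sub_le (P (s n) (P t x - P (s N) w)) (P t x - P (s N) w)
  have h3 := (P (s n)).le_of_opNorm_le (hr _) (P t x - P (s N) w)
  linarith

/-- A net that is not Cauchy yields a sequence with jumps at least ε. Its indices in Γ increase
strictly, since equal indices give no jump, contradicting the sequential case. -/
theorem exists_tendsto [CompleteSpace X] (hP : IsProjectionalSkeleton P) {r : ℝ}
    (hr : ∀ s, ‖P s‖ ≤ r) {ι : Type*} [Preorder ι] [IsDirectedOrder ι] [Nonempty ι]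
    {v : ι → Γ} (hv : Monotone v) (x : X) : ∃ y, Tendsto (fun i => P (v i) x) atTop (𝓝 y) := by
  apply cauchySeq_tendsto_of_complete (u := fun i => P (v i) x) ?_
  suffices h : ∀ ε > 0, ∃ i, ∀ j ≥ i, ‖P (v j) x - P (v i) x‖ < ε by
    refine Metric.cauchy_iff.2 ⟨map_neBot, fun ε hε => ?_⟩
    obtain ⟨i, hi⟩ := h (ε / 2) (half_pos hε)
    refine ⟨_, image_mem_map (Ici_mem_atTop i), ?_⟩
    rintro _ ⟨j, hj, rfl⟩ _ ⟨k, hk, rfl⟩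
    have h1 := hi j hj
    have h2 := hi k hk
    rw [← dist_eq_norm] at h1 h2
    linarith [dist_triangle_right (P (v j) x) (P (v k) x) (P (v i) x)]
  by_contra! hcon
  obtain ⟨ε, hε, hcon⟩ := hcon
  choose g hg1 hg2 using hcon
  let i : ℕ → ι := fun n => g^[n] (Classical.arbitrary ι)
  have hi : ∀ n, i (n + 1) = g (i n) := fun n => Function.iterate_succ_apply' g n _
  have hs : StrictMono fun n => v (i n) := by
    refine strictMono_nat_of_lt_succ fun n => lt_of_le_of_ne (hv (hi n ▸ hg1 (i n))) fun h => ?_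
    have := hg2 (i n)
    rw [← hi, ← h, sub_self, norm_zero] at this
    linarith
  obtain ⟨N, hN⟩ := Metric.cauchySeq_iff'.1 (hP.cauchySeq_of_strictMono hr hs x) (ε / 2)
    (by positivity)
  have h1 := hN (N + 1) (by omega)
  have h2 := hg2 (i N)
  rw [← hi, ← dist_eq_norm] at h2
  linarith

theorem exists_clm_tendsto [CompleteSpace X] (hP : IsProjectionalSkeleton P) {r : ℝ}
    (hr : ∀ s, ‖P s‖ ≤ r) {ι : Type*} [Preorder ι] [IsDirectedOrder ι] [Nonempty ι]
    {v : ι → Γ} (hv : Monotone v) :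
    ∃ Q : X →L[𝕜] X, ‖Q‖ ≤ r ∧ ∀ x, Tendsto (fun i => P (v i) x) atTop (𝓝 (Q x)) := by
  choose q hq using hP.exists_tendsto hr hv
  have hr0 : 0 ≤ r := (norm_nonneg _).trans (hr (v (Classical.arbitrary ι)))
  let Q : X →ₗ[𝕜] X :=
    { toFun := q
      map_add' := fun x y => tendsto_nhds_unique (hq (x + y)) (by
        simpa only [map_add] using (hq x).add (hq y))
      map_smul' := fun c x => tendsto_nhds_unique (hq (c • x)) (by
        simpa only [map_smul, RingHom.id_apply] using (hq x).const_smul c) }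
  refine ⟨Q.mkContinuous r fun x => ?_, LinearMap.mkContinuous_norm_le _ hr0 _, hq⟩
  exact le_of_tendsto (hq x).norm (Eventually.of_forall fun i =>
    (P (v i)).le_of_opNorm_le (hr _) x)

end IsProjectionalSkeleton

/-! ### Limit projections over arbitrary subsets of Γ -/

/-- `R S` is the limit of the projections `P (u F)` over the finite subsets `F` of `S`. -/
structure IsLimitSystem {𝕜 X Γ : Type*} [RCLike 𝕜] [NormedAddCommGroup X] [NormedSpace 𝕜 X]
    [PartialOrder Γ] (P : Γ → X →L[𝕜] X) (r : ℝ) (u : Finset Γ → Γ)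
    (R : Set Γ → X →L[𝕜] X) : Prop where
  skeleton : IsProjectionalSkeleton P
  comm : ∀ s t, P s ∘L P t = P t ∘L P s
  monotone : Monotone u
  le : ∀ s, s ≤ u {s}
  norm_le : ∀ S, ‖R S‖ ≤ r
  tendsto : ∀ S x, Tendsto (fun F : {F : Finset Γ // (F : Set Γ) ⊆ S} => P (u F) x) atTop
    (𝓝 (R S x))

theorem isDirectedOrder_finset_subset {Γ : Type*} (S : Set Γ) :
    IsDirectedOrder {F : Finset Γ // (F : Set Γ) ⊆ S} := by
  classical
  exact ⟨fun F G => ⟨⟨F.1 ∪ G.1, by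
    rw [Finset.coe_union]; exact Set.union_subset F.2 G.2⟩,
    Finset.subset_union_left (s₁ := F.1), Finset.subset_union_right (s₂ := G.1)⟩⟩

theorem nonempty_finset_subset {Γ : Type*} (S : Set Γ) :
    Nonempty {F : Finset Γ // (F : Set Γ) ⊆ S} := ⟨⟨∅, by simp⟩⟩

attribute [local instance] isDirectedOrder_finset_subset nonempty_finset_subset

theorem IsProjectionalSkeleton.exists_isLimitSystem {𝕜 X Γ : Type*} [RCLike 𝕜]
    [NormedAddCommGroup X] [NormedSpace 𝕜 X] [CompleteSpace X] [PartialOrder Γ]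
    {P : Γ → X →L[𝕜] X} (hP : IsProjectionalSkeleton P) {r : ℝ} (hr : ∀ s, ‖P s‖ ≤ r)
    (hc : ∀ s t, P s ∘L P t = P t ∘L P s) : ∃ u R, IsLimitSystem P r u R := by
  have : Nonempty Γ := ⟨(hP.cover 0).choose⟩
  obtain ⟨u, hu, hle⟩ := exists_monotone_finset_upperBound hP.directed
  choose R hR1 hR2 using fun S : Set Γ =>
    hP.exists_clm_tendsto hr (v := fun F : {F : Finset Γ // (F : Set Γ) ⊆ S} => u F)
      fun F G h => hu h
  exact ⟨u, R, hP, hc, hu, hle, hR1, hR2⟩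

/-- Use a well-order of least type; as S is infinite, even closed initial segments are smaller than
S. -/
theorem exists_wellOrder_enumeration {Γ : Type v} {S : Set Γ} (hS : ¬ S.Countable) :
    ∃ (I : Type v) (_ : LinearOrder I) (_ : WellFoundedLT I) (i : I → Γ), Set.range i = S ∧
      ∀ a, Cardinal.mk (i '' Set.Iic a) < Cardinal.mk S := by
  obtain ⟨o, hwf, hord⟩ := Cardinal.exists_ord_eq_type_lt S
  have hinf : Cardinal.aleph0 ≤ Cardinal.mk S := by
    by_contra hlt
    exact hS (Cardinal.le_aleph0_iff_set_countable.1 (not_le.1 hlt).le)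
  exact ⟨S, o, hwf, (↑), Subtype.range_coe, fun a =>
    Cardinal.mk_image_le.trans_lt (Cardinal.mk_Iic_lt a hord hinf)⟩

namespace IsLimitSystem

variable {𝕜 X Γ : Type*} [RCLike 𝕜] [NormedAddCommGroup X] [NormedSpace 𝕜 X]
  [PartialOrder Γ] {P : Γ → X →L[𝕜] X} {r : ℝ} {u : Finset Γ → Γ} {R : Set Γ → X →L[𝕜] X}

theorem apply_of_subset (h : IsLimitSystem P r u R) {S : Set Γ} {F : Finset Γ}
    (hF : (F : Set Γ) ⊆ S) (x : X) : R S (P (u F) x) = P (u F) x := by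
  refine tendsto_nhds_unique (h.tendsto S _) (tendsto_const_nhds.congr' ?_)
  filter_upwards [eventually_ge_atTop (⟨F, hF⟩ : {F : Finset Γ // (F : Set Γ) ⊆ S})] with G hG
  exact (h.skeleton.apply_apply_of_ge (h.monotone hG) x).symm

theorem mem_closure (h : IsLimitSystem P r u R) (S : Set Γ) (x : X) :
    R S x ∈ closure (⋃ F : {F : Finset Γ // (F : Set Γ) ⊆ S}, Set.range (P (u F))) :=
  mem_closure_of_tendsto (h.tendsto S x) (Eventually.of_forall fun F =>
    Set.mem_iUnion.2 ⟨F, x, rfl⟩)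

theorem apply_comm (h : IsLimitSystem P r u R) (S : Set Γ) (s : Γ) (x : X) :
    P s (R S x) = R S (P s x) := by
  refine tendsto_nhds_unique (((P s).continuous.tendsto _).comp (h.tendsto S x))
    ((h.tendsto S (P s x)).congr fun F => ?_)
  exact DFunLike.congr_fun (h.comm (u F) s) x

theorem apply_limit_of_subset (h : IsLimitSystem P r u R) {F : Finset Γ} {S : Set Γ}
    (hF : (F : Set Γ) ⊆ S) (x : X) : P (u F) (R S x) = P (u F) x := by
  rw [h.apply_comm, h.apply_of_subset hF]

theorem apply_apply_of_subset (h : IsLimitSystem P r u R) {S T : Set Γ} (hST : S ⊆ T) (x : X) :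
    R S (R T x) = R S x :=
  tendsto_nhds_unique (h.tendsto S _) ((h.tendsto S x).congr fun F =>
    (h.apply_limit_of_subset (F.2.trans hST) x).symm)

/-- A finite subset of the union already lies in some S n, so the approximant P_{u F} w of the limit
is eventually fixed. -/
theorem tendsto_iUnion (h : IsLimitSystem P r u R) {S : ℕ → Set Γ} (hS : Monotone S) (x : X) :
    Tendsto (fun n => R (S n) x) atTop (𝓝 (R (⋃ n, S n) x)) := by
  set T := ⋃ n, S n with hT
  have hr0 : 0 ≤ r := (norm_nonneg _).trans (h.norm_le T)
  rw [Metric.tendsto_atTop]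
  intro ε hε
  obtain ⟨z, hz, hd⟩ := Metric.mem_closure_iff.1 (h.mem_closure T x) (ε / (r + 1))
    (by positivity)
  obtain ⟨⟨F, hF⟩, w, rfl⟩ := Set.mem_iUnion.1 hz
  obtain ⟨N, hN⟩ : ∃ N, (F : Set Γ) ⊆ S N :=
    hS.directed_le.exists_mem_subset_of_finset_subset_biUnion (s := F) (by simpa using hF)
  refine ⟨N, fun n hn => ?_⟩
  rw [dist_eq_norm, lt_div_iff₀ (by positivity)] at hd
  rw [dist_eq_norm]
  have h1 : R (S n) x - R T x = R (S n) (R T x - P (u F) w) - (R T x - P (u F) w) := by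
    rw [map_sub, h.apply_apply_of_subset (Set.subset_iUnion S n),
      h.apply_of_subset (hN.trans (hS hn))]
    abel
  rw [h1]
  have h2 := norm_sub_le (R (S n) (R T x - P (u F) w)) (R T x - P (u F) w)
  have h3 := (R (S n)).le_of_opNorm_le (h.norm_le _) (R T x - P (u F) w)
  linarith

/-- The increments of a well-ordered chain of limit projections at a given point vanish for all
but countably many indices. -/
theorem countable_increment_ne_zero (h : IsLimitSystem P r u R) {I : Type*} [LinearOrder I]
    [WellFoundedLT I] (i : I → Γ) (x : X) :
    {a : I | R (i '' Set.Iic a) x - R (i '' Set.Iio a) x ≠ 0}.Countable := by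
  set q : I → X := fun a => R (i '' Set.Iic a) x - R (i '' Set.Iio a) x with hq
  have hfin : ∀ ε > 0, {a : I | ε ≤ ‖q a‖}.Finite := by
    intro ε hε
    by_contra hinf
    let f := Set.Infinite.natEmbedding _ hinf
    -- Infinitely many large increments would contain a strictly increasing sequence of indices, as
    -- a well-order has no descending one.
    obtain ⟨g, hg⟩ := exists_increasing_or_nonincreasing_subseq (· < ·) fun n => (f n : I)
    have hmono : StrictMono fun n => (f (g n) : I) := by
      rcases hg with hg | hg
      · exact fun m n hmn => hg m n hmn
      · exfalso
        have hanti : StrictAnti fun n => (f (g n) : I) := fun m n hmn =>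
          lt_of_le_of_ne (not_lt.1 (hg m n hmn)) fun he =>
            hmn.ne' (g.injective (f.injective (Subtype.ext he)))
        exact (not_strictAnti_of_wellFoundedLT _) hanti
    set a : ℕ → I := fun n => f (g n) with ha
    have h1 := h.tendsto_iUnion (S := fun n => i '' Set.Iic (a n))
      (fun m n hmn => Set.image_mono (Set.Iic_subset_Iic.2 (hmono.monotone hmn))) x
    have h2 := h.tendsto_iUnion (S := fun n => (i '' Set.Iio (a n) : Set Γ))
      (fun m n hmn => Set.image_mono (Set.Iio_subset_Iio (hmono.monotone hmn))) x
    -- Each closed segment lies in the next open one, so both chains have the same limit and the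
    -- increments tend to 0.
    have heq : (⋃ n, (i '' Set.Iic (a n) : Set Γ)) = ⋃ n, (i '' Set.Iio (a n) : Set Γ) := by
      apply subset_antisymm
      · refine Set.iUnion_subset fun n => ?_
        refine Set.Subset.trans (Set.image_mono ?_)
          (Set.subset_iUnion (fun n => (i '' Set.Iio (a n) : Set Γ)) (n + 1))
        exact fun b hb => lt_of_le_of_lt hb (hmono (Nat.lt_succ_self n))
      · exact Set.iUnion_mono fun n => Set.image_mono Set.Iio_subset_Iic_self
    rw [heq] at h1
    have h3 : Tendsto (fun n => ‖q (a n)‖) atTop (𝓝 0) := by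
      simpa using (h1.sub h2).norm
    have h4 : ∀ n, ε ≤ ‖q (a n)‖ := fun n => (f (g n)).2
    exact absurd (ge_of_tendsto' h3 h4) (not_le.2 hε)
  have : {a : I | q a ≠ 0} ⊆ ⋃ n : ℕ, {a : I | 1 / ((n : ℝ) + 1) ≤ ‖q a‖} := by
    intro a ha
    obtain ⟨n, hn⟩ := exists_nat_one_div_lt (norm_pos_iff.2 ha)
    exact Set.mem_iUnion.2 ⟨n, hn.le⟩
  exact (Set.countable_iUnion fun n : ℕ => (hfin (1 / ((n : ℝ) + 1)) (by positivity)).countable).mono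
    this

theorem isSeparable_range_of_countable (h : IsLimitSystem P r u R) {S : Set Γ}
    (hS : S.Countable) : TopologicalSpace.IsSeparable (Set.range (R S)) := by
  have : Countable {F : Finset Γ // (F : Set Γ) ⊆ S} :=
    by
    have := (Set.countable_ofPred_finite_subset hS).to_subtype
    exact Function.Injective.countable (β := {t : Set Γ | t.Finite ∧ t ⊆ S})
      (f := fun F => ⟨F.1, F.1.finite_toSet, F.2⟩) fun F G hFG =>
        Subtype.ext (Finset.coe_injective (congrArg Subtype.val hFG))
  exact (TopologicalSpace.IsSeparable.iUnion fun F :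
    {F : Finset Γ // (F : Set Γ) ⊆ S} => h.skeleton.separable (u F)).closure.mono
    (by rintro _ ⟨x, rfl⟩; exact h.mem_closure S x)

theorem range_subset_of_forall (h : IsLimitSystem P r u R) {S : Set Γ} {M : Set X}
    (hM : IsClosed M) (hF : ∀ F : Finset Γ, (F : Set Γ) ⊆ S → Set.range (P (u F)) ⊆ M) :
    Set.range (R S) ⊆ M := by
  rintro _ ⟨x, rfl⟩
  have hsub : (⋃ F : {F : Finset Γ // (F : Set Γ) ⊆ S}, Set.range (P (u F))) ⊆ M :=
    Set.iUnion_subset fun F => hF F.1 F.2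
  exact closure_minimal hsub hM (h.mem_closure S x)

/-- The range of every limit projection has a linearly dense subset which is supported countably
by every functional factoring through some `P s`. -/
theorem exists_countablySupporting (h : IsLimitSystem P r u R) :
    ∀ S : Set Γ, ∃ A : Set X, Set.range (R S) ⊆ closure (Submodule.span 𝕜 A : Set X) ∧
      ∀ (s : Γ) (φ : StrongDual 𝕜 X), {a ∈ A | φ (P s a) ≠ 0}.Countable := by
  suffices H : ∀ (κ : Cardinal) (S : Set Γ), Cardinal.mk S = κ → ∃ A : Set X,
      Set.range (R S) ⊆ closure (Submodule.span 𝕜 A : Set X) ∧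
      ∀ (s : Γ) (φ : StrongDual 𝕜 X), {a ∈ A | φ (P s a) ≠ 0}.Countable from fun S => H _ S rfl
  intro κ
  induction κ using WellFoundedLT.induction with
  | ind κ ih =>
  rintro S rfl
  have hcount : ∀ T : Set Γ, T.Countable →
      ∃ A : Set X, A.Countable ∧ Set.range (R T) ⊆ closure (Submodule.span 𝕜 A : Set X) := by
    intro T hT
    obtain ⟨c, hc, hc'⟩ := h.isSeparable_range_of_countable hT
    exact ⟨c, hc, hc'.trans (closure_mono Submodule.subset_span)⟩
  by_cases hS : S.Countable
  · obtain ⟨A, hA, hA'⟩ := hcount S hS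
    exact ⟨A, hA', fun s φ => hA.mono (Set.sep_subset _ _)⟩
  obtain ⟨I, _, _, i, rfl, hIic⟩ := exists_wellOrder_enumeration hS
  choose A hA1 hA2 using fun a : I => ih _ (hIic a) _ rfl
  -- The increments do not account for the starting term R ∅ of the chain; A₀ does.
  obtain ⟨A₀, hA₀, hA₀'⟩ := hcount ∅ Set.countable_empty
  set Q : I → X →L[𝕜] X := fun a => R (i '' Set.Iic a) - R (i '' Set.Iio a) with hQ
  have hQapp : ∀ a x, Q a x = R (i '' Set.Iic a) x - R (i '' Set.Iio a) x := fun _ _ => rfl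
  have hPQ : ∀ s a x, P s (Q a x) = Q a (P s x) := fun s a x => by
    rw [hQapp, hQapp, map_sub, h.apply_comm, h.apply_comm]
  set B : Set X := A₀ ∪ ⋃ a, Q a '' A a with hB
  set M : Submodule 𝕜 X := (Submodule.span 𝕜 B).topologicalClosure with hM
  have hMc : IsClosed (M : Set X) := Submodule.isClosed_topologicalClosure _
  have hBM : B ⊆ M := Submodule.subset_span.trans (Submodule.le_topologicalClosure _)
  refine ⟨B, ?_, fun s φ => ?_⟩
  · change Set.range (R (Set.range i)) ⊆ M
    have hempty : Set.range (P (u ∅)) ⊆ M := by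
      rintro _ ⟨x, rfl⟩
      rw [← h.apply_of_subset (S := ∅) (F := ∅) (by simp)]
      exact closure_mono (Submodule.span_mono Set.subset_union_left) (hA₀' ⟨_, rfl⟩)
    have hQM : ∀ a x, Q a x ∈ M := by
      intro a x
      -- Since Q a factors through R of the closed segment, the image of A a is linearly dense in
      -- its range.
      have h1 : Q a x = Q a (R (i '' Set.Iic a) x) := by
        rw [hQapp, hQapp, h.apply_apply_of_subset subset_rfl,
          h.apply_apply_of_subset (Set.image_mono Set.Iio_subset_Iic_self)]
      rw [h1]
      have h2 : Submodule.span 𝕜 (A a) ≤ M.comap (Q a : X →ₗ[𝕜] X) := by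
        rw [Submodule.span_le]
        exact fun b hb => hBM (Or.inr (Set.mem_iUnion.2 ⟨a, b, hb, rfl⟩))
      exact closure_minimal h2 (hMc.preimage (Q a).continuous) (hA1 a ⟨x, rfl⟩)
    -- A finite part of K lies below its maximum. This serves limit stages and the final one alike.
    have hstep : ∀ K : Set I, (∀ a ∈ K, Set.range (R (i '' Set.Iic a)) ⊆ M) →
        Set.range (R (i '' K)) ⊆ M := by
      intro K hK
      classical
      refine h.range_subset_of_forall hMc fun F hF => ?_
      obtain ⟨G, hG, rfl⟩ := Finset.subset_set_image_iff.1 hF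
      rcases G.eq_empty_or_nonempty with rfl | hne
      · simpa using hempty
      · refine Set.Subset.trans ?_ (hK (G.max' hne) (hG (G.max'_mem hne)))
        rintro _ ⟨x, rfl⟩
        refine ⟨_, h.apply_of_subset ?_ x⟩
        rw [Finset.coe_image]
        exact Set.image_mono fun b hb => G.le_max' b hb
    have hall : ∀ a : I, Set.range (R (i '' Set.Iic a)) ⊆ M := by
      intro a
      induction a using WellFoundedLT.induction with
      | ind a iha =>
      have hlt := hstep (Set.Iio a) iha
      rintro _ ⟨x, rfl⟩
      have : R (i '' Set.Iic a) x = Q a x + R (i '' Set.Iio a) x := by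
        rw [hQapp, sub_add_cancel]
      rw [this]
      exact M.add_mem (hQM a x) (hlt ⟨x, rfl⟩)
    have := hstep Set.univ fun a _ => hall a
    rwa [Set.image_univ] at this
  · obtain ⟨c, hc, hc'⟩ := h.skeleton.separable s
    -- Outside this countable set, Q a kills a dense part of P_s X, hence all of it.
    set J : Set I := ⋃ d ∈ c, {a | Q a d ≠ 0} with hJ
    have hJc : J.Countable := hc.biUnion fun d _ => h.countable_increment_ne_zero i d
    have hJ0 : ∀ a ∉ J, ∀ x, Q a (P s x) = 0 := by
      intro a ha x
      have h0 : c ⊆ {y | Q a y = 0} := fun d hd => by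
        by_contra hne
        exact ha (Set.mem_biUnion hd hne)
      exact closure_minimal h0 (isClosed_eq (Q a).continuous continuous_const) (hc' ⟨x, rfl⟩)
    -- As P_s commutes with Q a, the induction hypothesis applies to φ ∘ Q a for each a in J.
    refine (hA₀.union (hJc.biUnion fun a _ => (hA2 a s (φ.comp (Q a))).image (Q a))).mono ?_
    rintro b ⟨hb | hb, hne⟩
    · exact Or.inl hb
    · obtain ⟨a, b, hb', rfl⟩ := Set.mem_iUnion.1 hb
      rw [hPQ] at hne
      refine Or.inr (Set.mem_biUnion (x := a) ?_ ⟨b, ⟨hb', hne⟩, rfl⟩)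
      by_contra ha
      exact hne (by rw [hJ0 a ha, map_zero])

theorem apply_univ (h : IsLimitSystem P r u R) (x : X) : R Set.univ x = x := by
  obtain ⟨s, y, rfl⟩ := h.skeleton.cover x
  rw [← h.skeleton.apply_apply_of_ge (h.le s)]
  exact h.apply_of_subset (Set.subset_univ _) _

end IsLimitSystem

theorem HasCommutativeProjectionalSkeleton.isPlichko {𝕜 : Type w} {X : Type u} [RCLike 𝕜]
    [NormedAddCommGroup X] [NormedSpace 𝕜 X] [CompleteSpace X] {r : ℝ}
    (h : HasCommutativeProjectionalSkeleton.{u, v, w} 𝕜 X r) : IsPlichko.{u, w} 𝕜 X r := by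
  obtain ⟨Γ, _, P, hP, hr, hc⟩ := h
  obtain ⟨u, R, hR⟩ := hP.exists_isLimitSystem hr hc
  obtain ⟨A, hA1, hA2⟩ := hR.exists_countablySupporting Set.univ
  have hdense : Dense (Submodule.span 𝕜 A : Set X) := fun x => hA1 ⟨x, hR.apply_univ x⟩
  let T : WeakDual 𝕜 X →L[𝕜] (A → 𝕜) := ContinuousLinearMap.pi fun a =>
    (WeakBilin.eval (topDualPairing 𝕜 X) (a : X) : WeakDual 𝕜 X →L[𝕜] 𝕜)
  have hT : ∀ (φ : StrongDual 𝕜 X) (a : A), T (StrongDual.toWeakDual φ) a = φ a := fun _ _ => rfl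
  refine ⟨A, T, ?_, fun x => ?_⟩
  · rw [injective_iff_map_eq_zero]
    intro φ hφ
    obtain ⟨φ, rfl⟩ := StrongDual.toWeakDual.surjective φ
    have h0 : φ = 0 := ContinuousLinearMap.ext_on hdense fun a ha => by
      rw [← hT φ ⟨a, ha⟩, hφ]; rfl
    rw [h0, map_zero]
  · obtain ⟨s, y, rfl⟩ := hP.cover x
    set x := P s y with hx
    have hPx : P s x = x := hP.apply_apply_of_ge le_rfl y
    have hr0 : 0 ≤ r := (norm_nonneg _).trans (hr s)
    set D := {φ : StrongDual 𝕜 X | T (StrongDual.toWeakDual φ) ∈ sigmaProduct 𝕜 A} with hD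
    have hbdd : BddAbove ((fun φ : StrongDual 𝕜 X => ‖φ x‖ / ‖φ‖) '' (D \ {0})) := by
      refine ⟨‖x‖, ?_⟩
      rintro _ ⟨φ, -, rfl⟩
      exact div_le_of_le_mul₀ (norm_nonneg _) (norm_nonneg _)
        ((φ.le_opNorm x).trans_eq (mul_comm _ _))
    rcases eq_or_ne x 0 with h0 | h0
    · rw [h0, norm_zero]
      refine mul_nonneg hr0 (Real.sSup_nonneg ?_)
      rintro _ ⟨φ, -, rfl⟩
      positivity
    obtain ⟨g, hg1, hgx⟩ := exists_dual_vector'' 𝕜 x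
    set φ : StrongDual 𝕜 X := g.comp (P s) with hφ
    have hφx : ‖φ x‖ = ‖x‖ := by
      change ‖g (P s x)‖ = ‖x‖
      rw [hPx, hgx]; simp
    have hφ0 : φ ≠ 0 := by
      rintro h
      rw [h] at hφx
      exact h0 (norm_eq_zero.1 (by simpa using hφx.symm))
    have hφn : ‖φ‖ ≤ r := by
      refine (ContinuousLinearMap.opNorm_comp_le g (P s)).trans ?_
      have := mul_le_mul hg1 (hr s) (norm_nonneg _) zero_le_one
      linarith
    have hφD : φ ∈ D := by
      have hpre : ((↑) ⁻¹' {a ∈ A | g (P s a) ≠ 0} : Set A).Countable :=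
        (hA2 s g).preimage Subtype.val_injective
      refine hpre.mono fun a ha => ?_
      exact ⟨a.2, ha⟩
    have hle := le_csSup hbdd (Set.mem_image_of_mem _ (show φ ∈ D \ {0} from ⟨hφD, hφ0⟩))
    have hpos : 0 < ‖φ‖ := norm_pos_iff.2 hφ0
    -- Dividing by ‖φ‖ ≤ r is what produces the constant r.
    calc ‖x‖ ≤ r * (‖x‖ / ‖φ‖) := by
          rw [mul_div_assoc', le_div_iff₀ hpos, mul_comm]
          gcongr
      _ ≤ _ := by
          rw [← hφx]
          gcongr

end Skeleton

theorem theorem4 (𝕜 : Type w) (X : Type u) [RCLike 𝕜] [NormedAddCommGroup X]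
    [NormedSpace 𝕜 X] [CompleteSpace X] (r : ℝ) (hr : 1 ≤ r) :
    HasCommutativeProjectionalSkeleton.{u, max u v, w} 𝕜 X r ↔ IsPlichko.{u, w} 𝕜 X r :=
  ⟨fun h => h.isPlichko, fun h =>
    h.hasCommutativeProjectionalSkeleton (zero_lt_one.trans_le hr)⟩
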